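/- Let $p$ be a prime and let $A \subseteq \mathbb{Z}_p \setminus \{0\}$ be a set with exactly $k = p-3$ elements whose sum $\sum_{a \in A} a$ is nonzero in $\mathbb{Z}_p$. Then the elements of $A$ can be ordered as $(a_1, a_2, \ldots, a_k)$ in such a way that the partial sums $s_0 = 0$ and $s_j = a_1 + a_2 + \cdots + a_j$ ($1 \leq j \leq k$) are pairwise distinct, that is, $s_i \neq s_j$ for all $0 \leq i < j \leq k$. -/

import Mathlib

/-- The list `l = (a₁, …, a_k)` is an ordering of the elements of the finite set `A`:
every element of `A` occurs in it exactly once, and nothing else occurs. -/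
def IsOrderingOf {G : Type*} (A : Finset G) (l : List G) : Prop :=
  l.Nodup ∧ ∀ x, x ∈ l ↔ x ∈ A

/-- The partial sum `s_j = a₁ + ⋯ + a_j` of `l = (a₁, …, a_k)`, for `0 ≤ j ≤ k`; thus `s₀ = 0`. -/
def partialSum {G : Type*} [AddCommGroup G] (l : List G) (j : ℕ) : G :=
  (l.take j).sum

/-- No two of the partial sums `s₀, s₁, …, s_k` of `l = (a₁, …, a_k)` are equal. -/
def HasDistinctPartialSums {G : Type*} [AddCommGroup G] (l : List G) : Prop :=
  ∀ i j : ℕ, i < j → j ≤ l.length → partialSum l i ≠ partialSum l j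

/-- Alspach's Conjecture for the cyclic group `ℤ_n` and subsets of size `k`: every set `A` of `k`
nonzero elements of `ℤ_n` with nonzero sum has an ordering whose partial sums `s₀, …, s_k` are
pairwise distinct. -/
def AlspachConjecture (n k : ℕ) : Prop :=
  ∀ A : Finset (ZMod n), 0 ∉ A → A.card = k → ∑ a ∈ A, a ≠ 0 →
    ∃ l : List (ZMod n), IsOrderingOf A l ∧ HasDistinctPartialSums l

/-- The integers `v 0, …, v (2 * h - 2)` and the representatives `e i` of their differences modulo
`2 * h + 1` are both pairwise distinct and lie in a window of length `2 * h + 1`, so that both are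
pairwise incongruent. The differences avoid `s * c` and `-(s * (c + 1))`. -/
structure IsRainbowPath (h c : ℕ) (s lo : ℤ) (v e : ℕ → ℤ) : Prop where
  vertex_mem : ∀ i, i ≤ 2 * h - 2 → lo ≤ v i ∧ v i ≤ lo + 2 * h
  vertex_inj : ∀ i j, i < j → j ≤ 2 * h - 2 → v i ≠ v j
  diff_mem : ∀ i, i < 2 * h - 2 → -h ≤ e i ∧ e i ≤ h
  diff_inj : ∀ i j, i < j → j < 2 * h - 2 → e i ≠ e j
  diff_eq : ∀ i, i < 2 * h - 2 → ∃ q : ℤ, v (i + 1) - v i = e i + (2 * h + 1) * q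
  diff_ne : ∀ i, i < 2 * h - 2 → e i ≠ s * c ∧ e i ≠ -(s * (c + 1))

/-- The zigzag `0, 1, -1, 2, -2, …`. -/
def zigzag (m : ℕ) : ℤ := if m % 2 = 0 then -((m / 2 : ℕ) : ℤ) else (((m + 1) / 2 : ℕ) : ℤ)

/-- The differences `1, -2, 3, -4, …` of the zigzag, `zigzagStep m = zigzag m - zigzag (m - 1)`. -/
def zigzagStep (m : ℕ) : ℤ := if m % 2 = 0 then -(m : ℤ) else (m : ℤ)

/-- An inward zigzag around `h`, then an outward zigzag around `0` that leaves out the step of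
length `h + h % 2`. -/
def splitZigzag (h c i : ℕ) : ℤ :=
  if i < c then h + zigzag (c - 1 - i)
  else if i - c < h + h % 2 then zigzag (i - c)
  else if (i - c) % 2 = 0 then -(((i - c + 2) / 2 : ℕ) : ℤ) else (((i - c + 1) / 2 : ℕ) : ℤ)

/-- The differences of `splitZigzag h c`, reduced modulo `2 * h + 1` to the window `[-h, h]`. -/
def splitZigzagStep (h c i : ℕ) : ℤ :=
  if i + 1 < c then -zigzagStep (c - 1 - i)
  else if i + 1 = c then -h
  else if i - c + 1 < h + h % 2 then zigzagStep (i - c + 1)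
  else -zigzagStep (i - c + 2) + (if i % 2 = c % 2 then -(2 * h + 1 : ℤ) else (2 * h + 1 : ℤ))

/-- An inward zigzag around `h + 1`, then an outward zigzag around `0`, both of length below `h`. -/
def oddSplitZigzag (h i : ℕ) : ℤ :=
  if i < h - 1 then h + 1 + zigzag (h - 2 - i) else zigzag (i - (h - 1))

/-- The differences of `oddSplitZigzag h`, reduced modulo `2 * h + 1` to the window `[-h, h]`. -/
def oddSplitZigzagStep (h i : ℕ) : ℤ :=
  if i + 1 < h - 1 then -zigzagStep (h - 2 - i)
  else if i + 1 = h - 1 then h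
  else zigzagStep (i - (h - 1) + 1)

/-! ### The zigzag paths over the integers -/

theorem splitZigzagStep_cases (h c i : ℕ) :
    (i + 1 < c ∧ (c - 1 - i) % 2 = 0 ∧ splitZigzagStep h c i = (c - 1 - i : ℕ)) ∨
    (i + 1 < c ∧ (c - 1 - i) % 2 = 1 ∧ splitZigzagStep h c i = -(c - 1 - i : ℕ)) ∨
    (i + 1 = c ∧ splitZigzagStep h c i = -h) ∨
    (c ≤ i ∧ i - c + 1 < h + h % 2 ∧ (i - c) % 2 = 1 ∧
      splitZigzagStep h c i = -(i - c + 1 : ℕ)) ∨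
    (c ≤ i ∧ i - c + 1 < h + h % 2 ∧ (i - c) % 2 = 0 ∧ splitZigzagStep h c i = (i - c + 1 : ℕ)) ∨
    (c ≤ i ∧ h + h % 2 ≤ i - c + 1 ∧ (i - c) % 2 = 0 ∧
      splitZigzagStep h c i = (i - c + 2 : ℕ) - (2 * h + 1)) ∨
    (c ≤ i ∧ h + h % 2 ≤ i - c + 1 ∧ (i - c) % 2 = 1 ∧
      splitZigzagStep h c i = -(i - c + 2 : ℕ) + (2 * h + 1)) := by
  unfold splitZigzagStep zigzagStep
  by_cases h1 : i + 1 < c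
  · rw [if_pos h1]
    rcases Nat.mod_two_eq_zero_or_one (c - 1 - i) with h2 | h2
    · exact Or.inl ⟨h1, h2, by rw [if_pos h2, neg_neg]⟩
    · exact Or.inr (Or.inl ⟨h1, h2, by rw [if_neg (by omega)]⟩)
  refine Or.inr (Or.inr ?_)
  rw [if_neg h1]
  by_cases h2 : i + 1 = c
  · exact Or.inl ⟨h2, by rw [if_pos h2]⟩
  refine Or.inr ?_
  rw [if_neg h2]
  by_cases h3 : i - c + 1 < h + h % 2
  · rw [if_pos h3]
    rcases Nat.mod_two_eq_zero_or_one (i - c) with h4 | h4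
    · exact Or.inr (Or.inl ⟨by omega, h3, h4, by rw [if_neg (by omega)]⟩)
    · exact Or.inl ⟨by omega, h3, h4, by rw [if_pos (by omega)]⟩
  refine Or.inr (Or.inr ?_)
  rw [if_neg h3]
  rcases Nat.mod_two_eq_zero_or_one (i - c) with h4 | h4
  · refine Or.inl ⟨by omega, by omega, h4, ?_⟩
    rw [if_pos (by omega), if_pos (by omega)]
    ring
  · refine Or.inr ⟨by omega, by omega, h4, ?_⟩
    rw [if_neg (by omega), if_neg (by omega)]

theorem splitZigzagStep_ne (h c i j : ℕ) (hch : c + 1 ≤ h)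
    (hij : i < j) (hj : j < 2 * h - 2) : splitZigzagStep h c i ≠ splitZigzagStep h c j := by
  intro heq
  rcases splitZigzagStep_cases h c i with hi | hi | hi | hi | hi | hi | hi <;>
  rcases splitZigzagStep_cases h c j with hj' | hj' | hj' | hj' | hj' | hj' | hj' <;>
  omega

theorem splitZigzag_ne (h c i j : ℕ) (hc : 1 ≤ c) (hch : c + 1 ≤ h)
    (hij : i < j) (hj : j ≤ 2 * h - 2) :
    splitZigzag h c i ≠ splitZigzag h c j := by
  unfold splitZigzag zigzag
  split_ifs <;> omega

theorem splitZigzag_succ_sub (h c i : ℕ) (hch : c + 1 ≤ h) :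
    ∃ q : ℤ, splitZigzag h c (i + 1) - splitZigzag h c i =
      splitZigzagStep h c i + (2 * h + 1) * q := by
  rcases splitZigzagStep_cases h c i with hi | hi | hi | hi | hi | hi | hi
  · refine ⟨0, ?_⟩
    rw [hi.2.2]
    unfold splitZigzag zigzag
    split_ifs <;> omega
  · refine ⟨0, ?_⟩
    rw [hi.2.2]
    unfold splitZigzag zigzag
    split_ifs <;> omega
  · refine ⟨0, ?_⟩
    rw [hi.2]
    unfold splitZigzag zigzag
    split_ifs <;> omega
  · refine ⟨0, ?_⟩
    rw [hi.2.2.2]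
    unfold splitZigzag zigzag
    split_ifs <;> omega
  · refine ⟨0, ?_⟩
    rw [hi.2.2.2]
    unfold splitZigzag zigzag
    split_ifs <;> omega
  · refine ⟨1, ?_⟩
    rw [hi.2.2.2]
    unfold splitZigzag zigzag
    split_ifs <;> omega
  · refine ⟨-1, ?_⟩
    rw [hi.2.2.2]
    unfold splitZigzag zigzag
    split_ifs <;> omega

/-- Lengths c and c + 1 occur only with sign + if odd and - if even: inward lengths are below c, and
reduced ones are at least c + 2. The joining step -h breaks this only if c + 1 = h is odd, hence
`hodd`. -/
theorem splitZigzagStep_avoids (h c i : ℕ) (hc : 1 ≤ c) (hch : c + 1 ≤ h)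
    (hodd : c + 1 = h → h % 2 = 0) (hi : i < 2 * h - 2) :
    splitZigzagStep h c i ≠ (if c % 2 = 0 then 1 else -1) * c ∧
      splitZigzagStep h c i ≠ -((if c % 2 = 0 then 1 else -1) * (c + 1)) := by
  rcases splitZigzagStep_cases h c i with h' | h' | h' | h' | h' | h' | h' <;>
    split_ifs <;> omega

theorem splitZigzag_isRainbowPath (h c : ℕ) (hc : 1 ≤ c) (hch : c + 1 ≤ h)
    (hodd : c + 1 = h → h % 2 = 0) :
    IsRainbowPath h c (if c % 2 = 0 then 1 else -1) (-((2 * h - c) / 2 : ℕ))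
      (splitZigzag h c) (splitZigzagStep h c) where
  vertex_mem i hi := by
    unfold splitZigzag zigzag
    split_ifs <;> omega
  vertex_inj i j hij hj := splitZigzag_ne h c i j hc hch hij hj
  diff_mem i hi := by
    rcases splitZigzagStep_cases h c i with h' | h' | h' | h' | h' | h' | h' <;> omega
  diff_inj i j hij hj := splitZigzagStep_ne h c i j hch hij hj
  diff_eq i _ := splitZigzag_succ_sub h c i hch
  diff_ne i hi := splitZigzagStep_avoids h c i hc hch hodd hi

/-- Here -h itself must be avoided; the centre h + 1 makes the joining step -(h + 1), which is
congruent to h. -/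
theorem oddSplitZigzag_isRainbowPath (h : ℕ) (hh : 2 ≤ h) (hodd : h % 2 = 1) :
    IsRainbowPath h (h - 1) 1 (-((h - 1) / 2 : ℕ)) (oddSplitZigzag h) (oddSplitZigzagStep h) where
  vertex_mem i hi := by
    unfold oddSplitZigzag zigzag
    split_ifs <;> omega
  vertex_inj i j hij hj := by
    unfold oddSplitZigzag zigzag
    split_ifs <;> omega
  diff_mem i hi := by
    unfold oddSplitZigzagStep zigzagStep
    split_ifs <;> omega
  diff_inj i j hij hj := by
    unfold oddSplitZigzagStep zigzagStep
    split_ifs <;> omega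
  diff_eq i hi := by
    refine ⟨if i + 1 = h - 1 then -1 else 0, ?_⟩
    unfold oddSplitZigzag oddSplitZigzagStep zigzag zigzagStep
    split_ifs <;> omega
  diff_ne i hi := by
    unfold oddSplitZigzagStep zigzagStep
    split_ifs <;> omega

theorem exists_isRainbowPath (h c : ℕ) (hc : 1 ≤ c) (hch : c + 1 ≤ h) :
    ∃ (s lo : ℤ) (v e : ℕ → ℤ), (s = 1 ∨ s = -1) ∧ IsRainbowPath h c s lo v e := by
  by_cases hodd : c + 1 = h ∧ h % 2 = 1
  · obtain rfl : c = h - 1 := by omega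
    exact ⟨_, _, _, _, Or.inl rfl, oddSplitZigzag_isRainbowPath h (by omega) hodd.2⟩
  · refine ⟨_, _, _, _, ?_, splitZigzag_isRainbowPath h c hc hch (by omega)⟩
    split_ifs <;> simp

/-! ### From integer paths to orderings modulo p -/

/-- Equality modulo `n` of two integers in a window of length `n`. -/
theorem eq_of_intCast_zmod_eq {n : ℕ} {a b lo : ℤ} (hab : (a : ZMod n) = b)
    (ha : lo ≤ a ∧ a < lo + n) (hb : lo ≤ b ∧ b < lo + n) : a = b := by
  have h := (ZMod.intCast_eq_intCast_iff_dvd_sub a b n).1 hab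
  have := Int.eq_zero_of_abs_lt_dvd h (by rw [abs_lt]; constructor <;> omega)
  omega

theorem sum_take_map_range_sub {G : Type*} [AddCommGroup G] (w : ℕ → G) (k j : ℕ) (hj : j ≤ k) :
    (((List.range k).map fun i => w (i + 1) - w i).take j).sum = w j - w 0 := by
  rw [← List.map_take, List.take_range, min_eq_left hj]
  induction j with
  | zero => simp
  | succ j ih => simp [List.range_succ, ih (by omega)]

/-- A sequence of distinct vertices whose differences are distinct elements of `A`, as many as `A`
has, gives an ordering of `A` with distinct partial sums. -/
theorem exists_ordering_of_vertices {G : Type*} [AddCommGroup G] (A : Finset G) (k : ℕ)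
    (hA : A.card = k) (w : ℕ → G) (hw : ∀ i j, i < j → j ≤ k → w i ≠ w j)
    (hd : ∀ i j, i < j → j < k → w (i + 1) - w i ≠ w (j + 1) - w j)
    (hmem : ∀ i, i < k → w (i + 1) - w i ∈ A) :
    ∃ l : List G, IsOrderingOf A l ∧ HasDistinctPartialSums l := by
  classical
  set l := (List.range k).map fun i => w (i + 1) - w i with hl
  have hnodup : l.Nodup := by
    refine List.Nodup.map_on ?_ List.nodup_range
    intro i hi j hj hij
    rw [List.mem_range] at hi hj
    rcases lt_trichotomy i j with h | h | h
    · exact absurd hij (hd i j h hj)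
    · exact h
    · exact absurd hij.symm (hd j i h hi)
  have hsub : l.toFinset ⊆ A := by
    intro x hx
    simp only [hl, List.mem_toFinset, List.mem_map, List.mem_range] at hx
    obtain ⟨i, hi, rfl⟩ := hx
    exact hmem i hi
  have heq : l.toFinset = A := by
    refine Finset.eq_of_subset_of_card_le hsub ?_
    rw [List.toFinset_card_of_nodup hnodup, hA]
    simp [hl]
  refine ⟨l, ⟨hnodup, fun x => by rw [← heq, List.mem_toFinset]⟩, fun i j hij hj => ?_⟩
  have hjk : j ≤ k := by simpa [hl] using hj
  unfold partialSum
  rw [hl, sum_take_map_range_sub w k i (by omega), sum_take_map_range_sub w k j hjk]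
  exact fun h => hw i j hij hjk (sub_left_injective h)

theorem exists_ordering_of_scaled_compl {h c : ℕ} [Fact (2 * h + 1).Prime] (hc : 1 ≤ c)
    (hch : c + 1 ≤ h) (A : Finset (ZMod (2 * h + 1))) (hA : A.card = 2 * h - 2)
    (u : ZMod (2 * h + 1)) (hu : u ≠ 0)
    (hcompl : ∀ a, a ≠ 0 → a ≠ u * c → a ≠ -(u * (c + 1)) → a ∈ A) :
    ∃ l : List (ZMod (2 * h + 1)), IsOrderingOf A l ∧ HasDistinctPartialSums l := by
  obtain ⟨s, lo, v, e, hs, H⟩ := exists_isRainbowPath h c hc hch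
  have hs2 : (s : ZMod (2 * h + 1)) * s = 1 := by rcases hs with rfl | rfl <;> simp
  have hs0 : (s : ZMod (2 * h + 1)) ≠ 0 := left_ne_zero_of_mul_eq_one hs2
  -- As s² = 1, scaling the path by `u * s` turns its avoided differences into u c and -u (c + 1).
  have hus : u * s ≠ 0 := mul_ne_zero hu hs0
  have hp : ((2 * h + 1 : ℤ) : ZMod (2 * h + 1)) = 0 := by
    exact_mod_cast ZMod.natCast_self (2 * h + 1)
  have hvinj : ∀ i j, i < j → j ≤ 2 * h - 2 → (v i : ZMod (2 * h + 1)) ≠ v j := by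
    intro i j hij hj h'
    have := H.vertex_mem i (by omega)
    have := H.vertex_mem j hj
    exact H.vertex_inj i j hij hj
      (eq_of_intCast_zmod_eq (lo := lo) h' (by omega) (by omega))
  have hdiff : ∀ i, i < 2 * h - 2 → (v (i + 1) : ZMod (2 * h + 1)) - v i = e i := by
    intro i hi
    obtain ⟨q, hq⟩ := H.diff_eq i hi
    rw [← Int.cast_sub, hq, Int.cast_add, Int.cast_mul, hp, zero_mul, add_zero]
  have hwdiff : ∀ i, i < 2 * h - 2 →
      u * s * (v (i + 1) : ZMod (2 * h + 1)) - u * s * v i = u * s * e i := by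
    intro i hi
    rw [← mul_sub, hdiff i hi]
  have hc1 : -(h : ℤ) ≤ s * c ∧ s * c ≤ h := by rcases hs with rfl | rfl <;> omega
  have hc2 : -(h : ℤ) ≤ -(s * (c + 1)) ∧ -(s * (c + 1)) ≤ h := by
    rcases hs with rfl | rfl <;> omega
  refine exists_ordering_of_vertices A _ hA (fun i => u * s * v i) ?_ ?_ ?_
  · intro i j hij hj h'
    exact hvinj i j hij hj (mul_left_cancel₀ hus h')
  · intro i j hij hj h'
    simp only [hwdiff i (by omega), hwdiff j hj] at h'
    have := H.diff_mem i (by omega)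
    have := H.diff_mem j hj
    exact H.diff_inj i j hij hj
      (eq_of_intCast_zmod_eq (lo := -h) (mul_left_cancel₀ hus h') (by omega) (by omega))
  · intro i hi
    have hm := H.diff_mem i hi
    have hne := H.diff_ne i hi
    simp only [hwdiff i hi]
    refine hcompl _ ?_ ?_ ?_
    · rw [← hwdiff i hi, ← mul_sub]
      exact mul_ne_zero hus (sub_ne_zero.2 (hvinj i (i + 1) (by omega) (by omega)).symm)
    · intro h'
      have h2 : u * s * (e i : ZMod (2 * h + 1)) = u * s * ((s * c : ℤ) : ZMod (2 * h + 1)) := by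
        rw [h']; push_cast; linear_combination (-u * c) * hs2
      exact hne.1 (eq_of_intCast_zmod_eq (lo := -h) (mul_left_cancel₀ hus h2)
        (by omega) (by omega))
    · intro h'
      have h2 : u * s * (e i : ZMod (2 * h + 1)) =
          u * s * ((-(s * (c + 1)) : ℤ) : ZMod (2 * h + 1)) := by
        rw [h']; push_cast; linear_combination (u * (c + 1)) * hs2
      exact hne.2 (eq_of_intCast_zmod_eq (lo := -h) (mul_left_cancel₀ hus h2)
        (by omega) (by omega))

/-! ### The two missing residues -/

/-- Two distinct nonzero residues with nonzero sum are, up to order and a common factor, `c` and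
`-(c + 1)` with `1 ≤ c < h`. -/
theorem exists_scaled_pair {h : ℕ} [Fact (2 * h + 1).Prime] (x y : ZMod (2 * h + 1)) (hx : x ≠ 0)
    (hy : y ≠ 0) (hxy : x ≠ y) (hsum : x + y ≠ 0) :
    ∃ (c : ℕ) (u : ZMod (2 * h + 1)), 1 ≤ c ∧ c + 1 ≤ h ∧ u ≠ 0 ∧
      ((x = u * c ∧ y = -(u * (c + 1))) ∨ (y = u * c ∧ x = -(u * (c + 1)))) := by
  have hp : (2 * h + 1 : ZMod (2 * h + 1)) = 0 := by
    exact_mod_cast ZMod.natCast_self (2 * h + 1)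
  -- Scaling to x + y = 1 turns the pair into n and 1 - n. The excluded values 0, 1 and h + 1 = 1/2
  -- mean x = 0, y = 0 and x = y.
  set n := (x / (x + y)).val with hn
  have hlt : n < 2 * h + 1 := ZMod.val_lt _
  have hxn : x = (x + y) * n := by
    rw [hn, ZMod.natCast_zmod_val]; field_simp
  have hn0 : n ≠ 0 := by
    intro h0
    rw [h0] at hxn
    exact hx (by simpa using hxn)
  have hn1 : n ≠ 1 := by
    intro h1
    rw [h1] at hxn
    exact hy (by linear_combination -hxn)
  have hnh : n ≠ h + 1 := by
    intro h1
    rw [h1] at hxn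
    push_cast at hxn
    exact hxy (by linear_combination 2 * hxn + (x + y) * hp)
  rcases Nat.lt_or_ge n (h + 1) with hlt' | hge
  · obtain ⟨c, hcn⟩ : ∃ c, n = c + 1 := ⟨n - 1, by omega⟩
    rw [hcn] at hxn
    refine ⟨c, -(x + y), by omega, by omega, neg_ne_zero.2 hsum, Or.inr ⟨?_, ?_⟩⟩
    · push_cast at hxn; linear_combination -hxn
    · push_cast at hxn; linear_combination hxn
  · obtain ⟨c, hcn⟩ : ∃ c, n + c = 2 * h + 1 := ⟨2 * h + 1 - n, by omega⟩
    have hcn' : (n : ZMod (2 * h + 1)) + c = 0 := by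
      rw [← hp]; exact_mod_cast congrArg (Nat.cast : ℕ → ZMod (2 * h + 1)) hcn
    refine ⟨c, -(x + y), by omega, by omega, neg_ne_zero.2 hsum, Or.inl ⟨?_, ?_⟩⟩
    · linear_combination hxn + (x + y) * hcn'
    · linear_combination -hxn - (x + y) * hcn'

theorem sum_zmod_univ_eq_zero (h : ℕ) : ∑ a : ZMod (2 * h + 1), a = 0 := by
  have h1 : ∑ a : ZMod (2 * h + 1), a = -∑ a : ZMod (2 * h + 1), a := by
    rw [← Finset.sum_neg_distrib]
    exact (Equiv.sum_comp (Equiv.neg _) fun a => a).symm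
  have hp : (2 * h + 1 : ZMod (2 * h + 1)) = 0 := by
    exact_mod_cast ZMod.natCast_self (2 * h + 1)
  -- The modulus is odd: -h is the inverse of 2.
  linear_combination (-(h : ZMod (2 * h + 1))) * h1 + (∑ a : ZMod (2 * h + 1), a) * hp

theorem theorem6 (p k : ℕ) (hp : p.Prime) (hk : k + 3 = p) : AlspachConjecture p k := by
  intro A h0 hcard hsum
  obtain ⟨h, rfl⟩ : ∃ h, p = 2 * h + 1 := hp.odd_of_ne_two (by rintro rfl; omega)
  have : Fact (2 * h + 1).Prime := ⟨hp⟩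
  obtain rfl : k = 2 * h - 2 := by omega
  have hcomplcard : ((insert 0 A)ᶜ).card = 2 := by
    rw [Finset.card_compl, ZMod.card, Finset.card_insert_of_notMem h0, hcard]; omega
  obtain ⟨x, y, hxy, hC⟩ := Finset.card_eq_two.1 hcomplcard
  have hC' : ∀ a, (a ≠ 0 ∧ a ∉ A) ↔ a = x ∨ a = y := by
    intro a
    have := Finset.ext_iff.1 hC a
    simpa using this
  have hsum' : x + y + ∑ a ∈ A, a = 0 := by
    have h1 := Finset.sum_compl_add_sum (insert 0 A) (fun a : ZMod (2 * h + 1) => a)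
    rwa [hC, Finset.sum_pair hxy, Finset.sum_insert h0, zero_add, sum_zmod_univ_eq_zero] at h1
  have hx := (hC' x).2 (Or.inl rfl)
  have hy := (hC' y).2 (Or.inr rfl)
  obtain ⟨c, u, hc, hch, hu, hpair⟩ := exists_scaled_pair x y hx.1 hy.1 hxy
    (fun h' => hsum (by rwa [h', zero_add] at hsum'))
  refine exists_ordering_of_scaled_compl hc hch A hcard u hu fun a ha0 ha1 ha2 => ?_
  by_contra haA
  rcases (hC' a).1 ⟨ha0, haA⟩ with rfl | rfl <;> rcases hpair with ⟨h1, h2⟩ | ⟨h1, h2⟩ <;>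
    first | exact ha1 h1 | exact ha2 h2
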